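/- Let $\mathfrak n$ be a finite-dimensional complex simple Lie algebra of type $B_n$, $n\ge 2$, with Cartan subalgebra $\mathfrak h$ and simple roots $\alpha_1,\dots,\alpha_n$ in the standard numbering (so that $\alpha_n$ is the short simple root and the highest root is $\alpha_1+2\alpha_2+\cdots+2\alpha_n$). Fix $2\le i\le n$ and put $\Sigma_i=\{\alpha_1,\alpha_i\}$. Define the height of a root $\alpha=\sum_{m} a_m\alpha_m$ with respect to $\Sigma_i$ by $\mathrm{ht}_{\Sigma_i}(\alpha)=a_1+a_i$, and let $\mathfrak n=\mathfrak n_{-3}\oplus\cdots\oplus\mathfrak n_3$ be the $|3|$-grading associated to $\Sigma_i$: $\mathfrak n_j$ is the sum of the root spaces of all roots of height $j$ with respect to $\Sigma_i$, together with $\mathfrak h$ if $j=0$. For $r\ge 0$ let $\mathfrak F_{r,3}=\mathfrak f_{-3}\oplus\mathfrak f_{-2}\oplus\mathfrak f_{-1}$ be the complex free nilpotent Lie algebra of step $3$ on $r$ generators (the free Lie algebra modulo all brackets of length at least $4$) with its canonical grading, in which $\mathfrak f_{-m}$ is spanned by the brackets of length $m$ in the generators. Then, for every $r$, there is no graded isomorphism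 between $\mathfrak F_{r,3}$ and $\mathfrak n_{-3}\oplus\mathfrak n_{-2}\oplus\mathfrak n_{-1}$; that is, no Lie algebra isomorphism $\mathfrak F_{r,3}\to\mathfrak n_{-3}\oplus\mathfrak n_{-2}\oplus\mathfrak n_{-1}$ maps $\mathfrak f_{-m}$ onto $\mathfrak n_{-m}$ for $m=1,2,3$. -/

import Mathlib

noncomputable section

/-! ## Graded isomorphisms -/

/-- A Lie algebra isomorphism `φ : A ≃ B` is graded, with respect to families `(𝒜 j)`, `(ℬ j)` of
homogeneous components indexed by `ℤ`, if it restricts to an isomorphism of `𝒜 j` onto `ℬ j`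
for every `j`. -/
def IsGradedIso {A B : Type*} [LieRing A] [LieAlgebra ℂ A] [LieRing B] [LieAlgebra ℂ B]
    (𝒜 : ℤ → Submodule ℂ A) (ℬ : ℤ → Submodule ℂ B) (φ : A ≃ₗ⁅ℂ⁆ B) : Prop :=
  ∀ j : ℤ, (𝒜 j).map (φ : A →ₗ[ℂ] B) = ℬ j

/-! ## Free nilpotent Lie algebras -/

/-- The complex free nilpotent Lie algebra `𝔉_{r,k}` with `r` generators and step `k`: the quotient
of the free Lie algebra `F` on `r` generators by the ideal of the lower central series spanned by
the brackets of length `> k`. (Mathlib's lower central series starts with `F` at index `0`.) -/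
abbrev FreeNilpotent (r k : ℕ) : Type :=
  FreeLieAlgebra ℂ (Fin r) ⧸
    LieModule.lowerCentralSeries ℂ (FreeLieAlgebra ℂ (Fin r)) (FreeLieAlgebra ℂ (Fin r)) k

/-- The `i`-th generator of `𝔉_{r,k}`. -/
def FreeNilpotent.gen (r k : ℕ) (i : Fin r) : FreeNilpotent r k :=
  LieSubmodule.Quotient.mk (FreeLieAlgebra.of ℂ i)

/-- The subspace of `𝔉_{r,k}` spanned by the brackets of length `m` in the generators: zero for
`m = 0`, the span of the generators for `m = 1`, and then recursively the span of all `⁅x, y⁆` with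
`x` a generator and `y` of length `m`. -/
def FreeNilpotent.brackets (r k : ℕ) : ℕ → Submodule ℂ (FreeNilpotent r k)
  | 0 => ⊥
  | 1 => Submodule.span ℂ (Set.range (FreeNilpotent.gen r k))
  | m + 2 => Submodule.span ℂ
      {z | ∃ i : Fin r, ∃ y ∈ FreeNilpotent.brackets r k (m + 1), z = ⁅FreeNilpotent.gen r k i, y⁆}

/-- The canonical grading `𝔉_{r,k} = 𝔣_{-k} ⊕ ⋯ ⊕ 𝔣_{-1}`, in which `𝔣_{-m}` is spanned by the
brackets of length `m` in the generators. -/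
def FreeNilpotent.grading (r k : ℕ) (j : ℤ) : Submodule ℂ (FreeNilpotent r k) :=
  FreeNilpotent.brackets r k (-j).toNat

/-! ## The grading of a simple Lie algebra attached to a set of simple roots -/

section RootGrading

variable {L : Type*} [LieRing L] [LieAlgebra ℂ L] [FiniteDimensional ℂ L] [LieAlgebra.IsSimple ℂ L]
  {H : LieSubalgebra ℂ L} [H.IsCartanSubalgebra]

/-- The simple roots `α_0, …, α_{n-1}` of the base `b` are a labelling of `b` for which the Cartan
matrix `⟨α_j, α_k^∨⟩` is the one of type `B_n`, the last root being the short one. -/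
def IsTypeB {n : ℕ} (b : (LieAlgebra.IsKilling.rootSystem H).Base) (α : Fin n ≃ b.support) : Prop :=
  ∀ j k : Fin n, b.cartanMatrix (α j) (α k) = CartanMatrix.B n j k

/-- The height with respect to a set `S` of simple roots, as a linear functional on the dual of the
Cartan subalgebra: `∑ a_s α_s ↦ ∑_{s ∈ S} a_s`. On roots it takes integer values. -/
def sigmaHeight (b : (LieAlgebra.IsKilling.rootSystem H).Base) (S : Finset b.support) :
    Module.Dual ℂ H →ₗ[ℂ] ℂ :=
  ∑ s ∈ S, b.toWeightBasis.coord s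

/-- The component `𝔫_j` of the grading attached to `S`: the sum of the root spaces of all roots of
height `j` with respect to `S`, together with the Cartan subalgebra (the weight space of the
weight `0`) if `j = 0`. -/
def sigmaGrading (b : (LieAlgebra.IsKilling.rootSystem H).Base) (S : Finset b.support) (j : ℤ) :
    Submodule ℂ L :=
  ⨆ χ : LieModule.Weight ℂ H L, ⨆ _ : sigmaHeight b S χ.toLinear = (j : ℂ),
    (LieAlgebra.rootSpace H χ).toSubmodule

lemma lie_mem_sigmaGrading (b : (LieAlgebra.IsKilling.rootSystem H).Base) (S : Finset b.support)
    {j k : ℤ} {x y : L} (hx : x ∈ sigmaGrading b S j) (hy : y ∈ sigmaGrading b S k) :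
    ⁅x, y⁆ ∈ sigmaGrading b S (j + k) := by
  have key : ∀ (χ ψ : LieModule.Weight ℂ H L), sigmaHeight b S χ.toLinear = (j : ℂ) →
      sigmaHeight b S ψ.toLinear = (k : ℂ) → ∀ u ∈ LieAlgebra.rootSpace H χ,
      ∀ v ∈ LieAlgebra.rootSpace H ψ, ⁅u, v⁆ ∈ sigmaGrading b S (j + k) := by
    intro χ ψ hχ hψ u hu v hv
    have huv := LieAlgebra.lie_mem_genWeightSpace_of_mem_genWeightSpace hu hv
    by_cases hbot : LieModule.genWeightSpace L ((χ : H → ℂ) + (ψ : H → ℂ)) = ⊥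
    · rw [hbot, LieSubmodule.mem_bot] at huv
      rw [huv]
      exact Submodule.zero_mem _
    · let ω : LieModule.Weight ℂ H L := ⟨(χ : H → ℂ) + (ψ : H → ℂ), hbot⟩
      have hω : ω.toLinear = χ.toLinear + ψ.toLinear := by
        ext z
        rfl
      refine Submodule.mem_iSup_of_mem ω (Submodule.mem_iSup_of_mem ?_ huv)
      rw [hω, map_add, hχ, hψ, Int.cast_add]
  rw [sigmaGrading] at hx hy
  induction hx using Submodule.iSup_induction' with
  | zero => simp
  | add u v _ _ hu hv => rw [add_lie]; exact add_mem hu hv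
  | mem χ u hu =>
    by_cases hχ : sigmaHeight b S χ.toLinear = (j : ℂ)
    swap
    · simp only [hχ, iSup_false, Submodule.mem_bot] at hu
      simp [hu]
    simp only [hχ, iSup_true] at hu
    induction hy using Submodule.iSup_induction' with
    | zero => simp
    | add v w _ _ hv hw => rw [lie_add]; exact add_mem hv hw
    | mem ψ v hv =>
      by_cases hψ : sigmaHeight b S ψ.toLinear = (k : ℂ)
      swap
      · simp only [hψ, iSup_false, Submodule.mem_bot] at hv
        simp [hv]
      simp only [hψ, iSup_true] at hv
      exact key χ ψ hχ hψ u hu v hv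

/-- The negative part `⨁_{j < 0} 𝔫_j` of the grading attached to `S`. (If the highest root has
height `3` with respect to `S`, it is `𝔫_{-3} ⊕ 𝔫_{-2} ⊕ 𝔫_{-1}`.) -/
def negativePart (b : (LieAlgebra.IsKilling.rootSystem H).Base) (S : Finset b.support) :
    LieSubalgebra ℂ L where
  toSubmodule := ⨆ j : {j : ℤ // j < 0}, sigmaGrading b S j
  lie_mem' := by
    intro x y hx hy
    change x ∈ ⨆ j : {j : ℤ // j < 0}, sigmaGrading b S j at hx
    change y ∈ ⨆ j : {j : ℤ // j < 0}, sigmaGrading b S j at hy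
    change ⁅x, y⁆ ∈ ⨆ j : {j : ℤ // j < 0}, sigmaGrading b S j
    induction hx using Submodule.iSup_induction' with
    | zero => simp
    | add u v _ _ hu hv => rw [add_lie]; exact add_mem hu hv
    | mem j u hu =>
      induction hy using Submodule.iSup_induction' with
      | zero => simp
      | add v w _ _ hv hw => rw [lie_add]; exact add_mem hv hw
      | mem k v hv =>
        exact Submodule.mem_iSup_of_mem (⟨j.1 + k.1, by have := j.2; have := k.2; omega⟩ :
          {j : ℤ // j < 0}) (lie_mem_sigmaGrading b S hu hv)

/-- The components of the negative part: `𝔫_j` in degree `j < 0`, and zero in degree `j ≥ 0`. -/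
def negativeGrading (b : (LieAlgebra.IsKilling.rootSystem H).Base) (S : Finset b.support) (j : ℤ) :
    Submodule ℂ (negativePart b S) :=
  if j < 0 then (sigmaGrading b S j).comap (negativePart b S).toSubmodule.subtype else ⊥

end RootGrading

end

/-! Both sides are distinguished by a single relation in degree `-3`.

In the free nilpotent Lie algebra of step `3`, two linearly independent elements `x`, `y` of
degree `-1` satisfy `⁅x, ⁅x, y⁆⁆ ≠ 0` (`FreeNilpotent.lie_lie_ne_zero`). Indeed there is a
homomorphism from the free Lie algebra to the strictly upper triangular `4 × 4` matrices with
`x ↦ E₀₁ + E₁₂` and `y ↦ E₂₃`; it kills the brackets of length at least `4`, and sends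
`⁅x, ⁅x, y⁆⁆` to `E₀₃`.

In a Lie algebra of type `B_n`, take `x` and `y` to be root vectors for `-α_1` and `-α_i`. They are
linearly independent, of degree `-1`, and `⁅x, ⁅x, y⁆⁆ = 0`, because the `α_1`-string through `α_i`
has length `-⟨α_i, α_1^∨⟩ ≤ 1`, so that `α_i + 2 α_1` is not a root
(`exists_lie_lie_eq_zero_of_simple_roots`).
-/

/-! ### A nilpotent filtration of matrices -/

-- The bracket on matrices is the commutator; Mathlib does not make this a global instance.
attribute [local instance 100] LieRing.ofAssociativeRing

/-- The `m × m` matrices supported on the entries `(i, j)` with `i + k ≤ j`. For `k = 1` these are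
the strictly upper triangular matrices. -/
def upperBand (m k : ℕ) : Submodule ℂ (Matrix (Fin m) (Fin m) ℂ) where
  carrier := {A | ∀ i j : Fin m, (j : ℕ) < i + k → A i j = 0}
  zero_mem' := fun _ _ _ ↦ rfl
  add_mem' := fun hA hB i j h ↦ by simp [hA i j h, hB i j h]
  smul_mem' := fun c A hA i j h ↦ by simp [hA i j h]

lemma mul_mem_upperBand {m k l : ℕ} {A B : Matrix (Fin m) (Fin m) ℂ}
    (hA : A ∈ upperBand m k) (hB : B ∈ upperBand m l) : A * B ∈ upperBand m (k + l) := by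
  intro i j h
  rw [Matrix.mul_apply]
  refine Finset.sum_eq_zero fun s _ ↦ ?_
  by_cases hs : (s : ℕ) < i + k
  · rw [hA i s hs, zero_mul]
  · rw [hB s j (by omega), mul_zero]

lemma lie_mem_upperBand {m k l : ℕ} {A B : Matrix (Fin m) (Fin m) ℂ}
    (hA : A ∈ upperBand m k) (hB : B ∈ upperBand m l) : ⁅A, B⁆ ∈ upperBand m (k + l) := by
  rw [Ring.lie_def]
  exact sub_mem (mul_mem_upperBand hA hB) (add_comm l k ▸ mul_mem_upperBand hB hA)

lemma upperBand_antitone (m : ℕ) : Antitone (upperBand m) :=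
  fun _ _ hkl _ hA i j h ↦ hA i j (by omega)

lemma eq_zero_of_mem_upperBand {m : ℕ} {A : Matrix (Fin m) (Fin m) ℂ}
    (hA : A ∈ upperBand m m) : A = 0 := by
  ext i j
  exact hA i j (by omega)

/-- The Lie algebra of strictly upper triangular `m × m` matrices. -/
def strictUpper (m : ℕ) : LieSubalgebra ℂ (Matrix (Fin m) (Fin m) ℂ) where
  toSubmodule := upperBand m 1
  lie_mem' := fun hA hB ↦ upperBand_antitone m (by omega) (lie_mem_upperBand hA hB)

lemma mem_upperBand_of_mem_lowerCentralSeries {F : Type*} [LieRing F] [LieAlgebra ℂ F] {m : ℕ}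
    (ψ : F →ₗ⁅ℂ⁆ strictUpper m) (k : ℕ) :
    ∀ z ∈ LieModule.lowerCentralSeries ℂ F F k,
      (ψ z : Matrix (Fin m) (Fin m) ℂ) ∈ upperBand m (k + 1) := by
  induction k with
  | zero => exact fun z _ ↦ (ψ z).2
  | succ k ih =>
    intro z hz
    rw [LieModule.lowerCentralSeries_succ, ← LieSubmodule.mem_toSubmodule,
      LieSubmodule.lieIdeal_oper_eq_linear_span'] at hz
    induction hz using Submodule.span_induction with
    | mem z hz =>
      obtain ⟨u, -, v, hv, rfl⟩ := hz
      rw [LieHom.map_lie, LieSubalgebra.coe_bracket, add_comm (k + 1) 1]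
      exact lie_mem_upperBand (ψ u).2 (ih v hv)
    | zero => simp
    | add u v _ _ hu hv => simpa using add_mem hu hv
    | smul c u _ hu => simpa using Submodule.smul_mem _ c hu

/-! ### Brackets in the free nilpotent Lie algebra of step three -/

/-- A pair of linearly independent vectors can be sent to any prescribed pair of vectors. -/
lemma LinearIndependent.exists_linearMap_pair {V W : Type*} [AddCommGroup V] [Module ℂ V]
    [AddCommGroup W] [Module ℂ W] {c d : V} (h : LinearIndependent ℂ ![c, d]) (u v : W) :
    ∃ g : V →ₗ[ℂ] W, g c = u ∧ g d = v := by
  obtain ⟨f, hf⟩ := LinearMap.exists_leftInverse_of_injective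
    (Fintype.linearCombination ℂ ![c, d])
    (LinearMap.ker_eq_bot.mpr (linearIndependent_iff_injective_fintypeLinearCombination.mp h))
  refine ⟨(Fintype.linearCombination ℂ ![u, v]) ∘ₗ f, ?_, ?_⟩
  · have hc : f c = ![1, 0] := by
      simpa [Fintype.linearCombination_apply] using LinearMap.congr_fun hf ![1, 0]
    simp [Fintype.linearCombination_apply, hc]
  · have hd : f d = ![0, 1] := by
      simpa [Fintype.linearCombination_apply] using LinearMap.congr_fun hf ![0, 1]
    simp [Fintype.linearCombination_apply, hd]

lemma FreeNilpotent.exists_eq_mk_of_mem_brackets_one {r k : ℕ} {x : FreeNilpotent r k}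
    (hx : x ∈ FreeNilpotent.brackets r k 1) :
    ∃ c : Fin r → ℂ,
      x = LieSubmodule.Quotient.mk (Fintype.linearCombination ℂ (FreeLieAlgebra.of ℂ) c) := by
  rw [FreeNilpotent.brackets, Submodule.mem_span_range_iff_exists_fun] at hx
  obtain ⟨c, rfl⟩ := hx
  refine ⟨c, ?_⟩
  rw [Fintype.linearCombination_apply, ← LieSubmodule.Quotient.mk'_apply, map_sum]
  rfl

/-- Linearly independent elements `x`, `y` of degree `-1` do not satisfy the relation
`⁅x, ⁅x, y⁆⁆ = 0`, since it fails for `x = E₀₁ + E₁₂` and `y = E₂₃`. -/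
theorem FreeNilpotent.lie_lie_ne_zero {r : ℕ} {x y : FreeNilpotent r 3}
    (hx : x ∈ FreeNilpotent.brackets r 3 1) (hy : y ∈ FreeNilpotent.brackets r 3 1)
    (hxy : LinearIndependent ℂ ![x, y]) : ⁅x, ⁅x, y⁆⁆ ≠ 0 := by
  obtain ⟨c, rfl⟩ := exists_eq_mk_of_mem_brackets_one hx
  obtain ⟨d, rfl⟩ := exists_eq_mk_of_mem_brackets_one hy
  set F := FreeLieAlgebra ℂ (Fin r)
  set l : (Fin r → ℂ) →ₗ[ℂ] F := Fintype.linearCombination ℂ (FreeLieAlgebra.of ℂ)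
  have hcd : LinearIndependent ℂ ![c, d] := by
    refine LinearIndependent.of_comp
      (((LieSubmodule.Quotient.mk' (LieModule.lowerCentralSeries ℂ F F 3)) :
        F →ₗ[ℂ] FreeNilpotent r 3) ∘ₗ l) ?_
    convert hxy using 1
    ext s
    fin_cases s <;> rfl
  let A : strictUpper 4 := ⟨!![0, 1, 0, 0; 0, 0, 1, 0; 0, 0, 0, 0; 0, 0, 0, 0], by
    intro i j h; fin_cases i <;> fin_cases j <;> simp at h ⊢⟩
  let B : strictUpper 4 := ⟨!![0, 0, 0, 0; 0, 0, 0, 0; 0, 0, 0, 1; 0, 0, 0, 0], by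
    intro i j h; fin_cases i <;> fin_cases j <;> simp at h ⊢⟩
  obtain ⟨g, hgc, hgd⟩ := hcd.exists_linearMap_pair A B
  let ψ : F →ₗ⁅ℂ⁆ strictUpper 4 := FreeLieAlgebra.lift ℂ fun s ↦ g (Pi.single s 1)
  have hψ (a : Fin r → ℂ) : ψ (l a) = g a := by
    have : (ψ : F →ₗ[ℂ] strictUpper 4) ∘ₗ l = g := by
      refine LinearMap.pi_ext' fun s ↦ LinearMap.ext_ring ?_
      have hl : l (Pi.single s 1) = FreeLieAlgebra.of ℂ s := by
        simp [l, Fintype.linearCombination_apply_single]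
      change ψ (l (Pi.single s 1)) = g (Pi.single s 1)
      rw [hl]
      exact FreeLieAlgebra.lift_of_apply (R := ℂ) (fun s ↦ g (Pi.single s 1)) s
    exact LinearMap.congr_fun this a
  intro h
  rw [← LieSubmodule.Quotient.mk_bracket, ← LieSubmodule.Quotient.mk_bracket,
    LieSubmodule.Quotient.mk_eq_zero'] at h
  have h0 := eq_zero_of_mem_upperBand (mem_upperBand_of_mem_lowerCentralSeries ψ 3 _ h)
  rw [LieHom.map_lie, LieHom.map_lie, hψ, hψ, hgc, hgd] at h0
  have h03 := congr_fun (congr_fun h0 0) 3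
  simp [A, B, Ring.lie_def] at h03

/-! ### Root vectors of two simple roots -/

section RootGrading

variable {L : Type*} [LieRing L] [LieAlgebra ℂ L] [FiniteDimensional ℂ L] [LieAlgebra.IsSimple ℂ L]
  {H : LieSubalgebra ℂ L} [H.IsCartanSubalgebra]

lemma mem_sigmaGrading_neg_one (b : (LieAlgebra.IsKilling.rootSystem H).Base)
    {S : Finset b.support} {s : b.support} (hs : s ∈ S) {x : L}
    (hx : x ∈ LieAlgebra.rootSpace H (-(s : LieModule.Weight ℂ H L))) :
    x ∈ sigmaGrading b S (-1) := by
  refine Submodule.mem_iSup_of_mem (-(s : LieModule.Weight ℂ H L))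
    (Submodule.mem_iSup_of_mem ?_ hx)
  have hroot : (s : LieModule.Weight ℂ H L).toLinear = b.toWeightBasis s := by simp
  rw [LieModule.Weight.toLinear_neg, map_neg, hroot, sigmaHeight, LinearMap.sum_apply]
  simp only [Module.Basis.coord_apply, Module.Basis.repr_self]
  rw [Finset.sum_eq_single s (fun u _ hu ↦ Finsupp.single_eq_of_ne hu) fun h ↦ absurd hs h]
  simp

/-- If `⟨α_t, α_s^∨⟩ ≥ -1`, then `α_t + 2 α_s` is not a weight. -/
lemma genWeightSpace_eq_bot_of_neg_one_le_cartanMatrix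
    (b : (LieAlgebra.IsKilling.rootSystem H).Base) {s t : b.support} (hst : s ≠ t)
    (hC : -1 ≤ b.cartanMatrix t s) :
    LieAlgebra.rootSpace H ((-(s : LieModule.Weight ℂ H L) : H → ℂ) +
      ((-(s : LieModule.Weight ℂ H L) : H → ℂ) + (-(t : LieModule.Weight ℂ H L) : H → ℂ))) = ⊥ := by
  by_contra hbot
  let P := LieAlgebra.IsKilling.rootSystem H
  have hli : LinearIndependent ℂ ![P.root s, P.root t] := b.linearIndependent_pair_of_ne hst
  let ω : LieModule.Weight ℂ H L := ⟨_, hbot⟩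
  have hω : (-ω).toLinear = P.root t + 2 • P.root s := by
    ext z
    simp [ω, P]
    ring
  have hne : (-ω).IsNonZero := by
    intro h0
    have hz : (2 : ℂ) • P.root s + (1 : ℂ) • P.root t = 0 := by
      rw [← LieModule.Weight.coe_toLinear_eq_zero_iff, hω] at h0
      rw [← h0]; module
    exact one_ne_zero (LinearIndependent.pair_iff.mp hli _ _ hz).2
  have hmem : P.root t + 2 • P.root s ∈ Set.range P.root :=
    ⟨⟨-ω, by simpa using hne⟩, hω⟩
  rw [P.root_add_nsmul_mem_range_iff_le_chainTopCoeff hli] at hmem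
  have htop := b.chainTopCoeff_eq_of_ne hst
  change _ = -b.cartanMatrix t s at htop
  omega

/-- The witnesses are root vectors for `-α_s` and `-α_t`. -/
theorem exists_lie_lie_eq_zero_of_simple_roots (b : (LieAlgebra.IsKilling.rootSystem H).Base)
    {S : Finset b.support} {s t : b.support} (hs : s ∈ S) (ht : t ∈ S) (hst : s ≠ t)
    (hC : -1 ≤ b.cartanMatrix t s) :
    ∃ x ∈ sigmaGrading b S (-1), ∃ y ∈ sigmaGrading b S (-1),
      LinearIndependent ℂ ![x, y] ∧ ⁅x, ⁅x, y⁆⁆ = 0 := by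
  obtain ⟨x, hx, hx0⟩ := (-(s : LieModule.Weight ℂ H L)).exists_ne_zero
  obtain ⟨y, hy, hy0⟩ := (-(t : LieModule.Weight ℂ H L)).exists_ne_zero
  refine ⟨x, mem_sigmaGrading_neg_one b hs hx, y, mem_sigmaGrading_neg_one b ht hy, ?_, ?_⟩
  · have hne : -(s : LieModule.Weight ℂ H L) ≠ -(t : LieModule.Weight ℂ H L) :=
      fun h ↦ hst (Subtype.ext (Subtype.ext (neg_injective h)))
    have hdisj := (LieModule.iSupIndep_genWeightSpace' ℂ H L).pairwiseDisjoint hne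
    rw [Function.onFun, ← LieSubmodule.disjoint_toSubmodule] at hdisj
    rw [LinearIndependent.pair_iff]
    intro p q hpq
    have hp : p • x = 0 := by
      refine Submodule.disjoint_def.mp hdisj _ (Submodule.smul_mem _ p hx) ?_
      rw [eq_neg_of_add_eq_zero_left hpq]
      exact neg_mem (Submodule.smul_mem _ q hy)
    rw [hp, zero_add] at hpq
    exact ⟨(smul_eq_zero.mp hp).resolve_right hx0, (smul_eq_zero.mp hpq).resolve_right hy0⟩
  · have h := LieAlgebra.lie_mem_genWeightSpace_of_mem_genWeightSpace hx
      (LieAlgebra.lie_mem_genWeightSpace_of_mem_genWeightSpace hx hy)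
    have hbot := genWeightSpace_eq_bot_of_neg_one_le_cartanMatrix b hst hC
    simp only [LieAlgebra.rootSpace, LieModule.Weight.coe_neg] at h hbot
    rwa [hbot, LieSubmodule.mem_bot] at h

end RootGrading

theorem mainTheorem5 {L : Type*} [LieRing L] [LieAlgebra ℂ L] [FiniteDimensional ℂ L]
    [LieAlgebra.IsSimple ℂ L] (H : LieSubalgebra ℂ L) [H.IsCartanSubalgebra]
    (b : (LieAlgebra.IsKilling.rootSystem H).Base)
    (n : ℕ) (α : Fin n ≃ b.support) (hα : IsTypeB b α)
    (i : ℕ) (hi : 2 ≤ i) (hin : i ≤ n)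
    (S : Finset b.support)
    (hS : S = Finset.map α.toEmbedding {⟨0, by omega⟩, ⟨i - 1, by omega⟩}) (r : ℕ) :
    ¬ ∃ φ : FreeNilpotent r 3 ≃ₗ⁅ℂ⁆ negativePart b S,
      IsGradedIso (FreeNilpotent.grading r 3) (negativeGrading b S) φ := by
  rintro ⟨φ, hφ⟩
  -- The first column of the Cartan matrix of type `B_n` has no entry `-2`, even for `n = 2`, since
  -- the short simple root is the last one.
  have hC : -1 ≤ b.cartanMatrix (α ⟨i - 1, by omega⟩) (α ⟨0, by omega⟩) := by
    rw [hα]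
    simp only [CartanMatrix.B, Matrix.of_apply, Fin.mk.injEq]
    split_ifs <;> omega
  obtain ⟨x, hx, y, hy, hli, hxy⟩ := exists_lie_lie_eq_zero_of_simple_roots b (S := S)
    (s := α ⟨0, by omega⟩) (t := α ⟨i - 1, by omega⟩) (by simp [hS]) (by simp [hS])
    (fun h ↦ by have := congrArg Fin.val (α.injective h); dsimp at this; omega) hC
  have hlift : ∀ z ∈ sigmaGrading b S (-1), ∃ w ∈ FreeNilpotent.brackets r 3 1, (φ w : L) = z := by
    intro z hz
    have hzneg : z ∈ negativePart b S :=
      Submodule.mem_iSup_of_mem (⟨-1, by omega⟩ : {j : ℤ // j < 0}) hz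
    have hz' : (⟨z, hzneg⟩ : negativePart b S) ∈ negativeGrading b S (-1) := by
      rw [negativeGrading, if_pos (by omega)]
      exact hz
    rw [← hφ (-1)] at hz'
    obtain ⟨w, hw, hwz⟩ := hz'
    exact ⟨w, hw, congrArg Subtype.val hwz⟩
  obtain ⟨u, hu, rfl⟩ := hlift x hx
  obtain ⟨v, hv, rfl⟩ := hlift y hy
  refine FreeNilpotent.lie_lie_ne_zero hu hv ?_ ?_
  · refine LinearIndependent.of_comp
      ((negativePart b S).toSubmodule.subtype ∘ₗ (φ : FreeNilpotent r 3 →ₗ[ℂ] negativePart b S)) ?_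
    convert hli using 1
    ext s
    fin_cases s <;> rfl
  · apply φ.injective
    apply Subtype.val_injective
    simpa using hxy
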